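/- Let $p\ge 1$, let $\rho>0$, and let $\widehat\Sigma\in\mathbb S_+^p$ be a (possibly singular) real symmetric positive semidefinite $p\times p$ matrix with spectral decomposition $\widehat\Sigma=\sum_{i=1}^p\lambda_i v_iv_i^\top$, where $\lambda_1,\dots,\lambda_p$ are its eigenvalues and $v_1,\dots,v_p$ corresponding orthonormal eigenvectors. Let $\mathcal N_0^p$ be the set of all (possibly degenerate) normal distributions $\mathcal N(0,S)$ on $\mathbb R^p$, $S\in\mathbb S^p_+$. Let $$\mathbb W(\mathbb P_1,\mathbb P_2)=\inf_{\Pi}\Big(\int_{\mathbb R^p\times\mathbb R^p}\|\xi_1-\xi_2\|^2\,\Pi(\mathrm d\xi_1,\mathrm d\xi_2)\Big)^{1/2}$$ be the type-2 Wasserstein distance with respect to the Euclidean norm, where $\Pi$ ranges over all joint distributions with marginals $\mathbb P_1$ and $\mathbb P_2$, and put $\mathcal P^0=\{\mathbb Q\in\mathcal N_0^p:\mathbb W(\mathbb Q,\mathcal N(0,\widehat\Sigma))\le\rho\}$. Consider the distributionally robust estimation problem $$\inf_{X\in\mathbb S_{++}^p}\Big\{-\log\det X+\sup_{\mathbb Q\in\mathcal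 P^0}\mathbb E^{\mathbb Q}\big[\langle\xi\xi^\top,X\rangle\big]\Big\},$$ where $\mathbb S_{++}^p$ is the set of real symmetric positive definite $p\times p$ matrices and $\langle A,B\rangle=\operatorname{Tr}(A^\top B)$. Then the equation $$\Big(\rho^2-\tfrac12\sum_{i=1}^p\lambda_i\Big)\gamma-p+\tfrac12\sum_{i=1}^p\sqrt{\lambda_i^2\gamma^2+4\lambda_i\gamma}=0$$ has a unique positive solution $\gamma^\star$, and the problem has a unique minimizer, which is $X^\star=\sum_{i=1}^p x_i^\star v_iv_i^\top$ with $$x_i^\star=\gamma^\star\Big[1-\tfrac12\Big(\sqrt{\lambda_i^2(\gamma^\star)^2+4\lambda_i\gamma^\star}-\lambda_i\gamma^\star\Big)\Big],\qquad i=1,\dots,p.$$ -/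

import Mathlib

open MeasureTheory ProbabilityTheory
open scoped ENNReal

noncomputable section

/-- `J` is a joint distribution with marginals `P₁` and `P₂`. -/
def IsCoupling {p : ℕ} (P₁ P₂ : Measure (EuclideanSpace ℝ (Fin p)))
    (J : Measure (EuclideanSpace ℝ (Fin p) × EuclideanSpace ℝ (Fin p))) : Prop :=
  J.fst = P₁ ∧ J.snd = P₂

/-- The type-2 Wasserstein distance on `ℝ^p` with its Euclidean norm, with values in `[0, ∞]`:
the infimum over all couplings of `(∫ ‖ξ₁ - ξ₂‖² dJ)^(1/2)`. -/
def wassersteinTwo {p : ℕ} (P₁ P₂ : Measure (EuclideanSpace ℝ (Fin p))) : ℝ≥0∞ :=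
  ⨅ (J : Measure (EuclideanSpace ℝ (Fin p) × EuclideanSpace ℝ (Fin p)))
    (_ : IsCoupling P₁ P₂ J), (∫⁻ z, ‖z.1 - z.2‖ₑ ^ 2 ∂J) ^ (1 / 2 : ℝ)

/-- The (possibly degenerate) normal distributions on `ℝ^p` with zero mean. -/
def centeredNormals (p : ℕ) : Set (Measure (EuclideanSpace ℝ (Fin p))) :=
  {Q | ∃ S : Matrix (Fin p) (Fin p) ℝ, S.PosSemidef ∧ Q = multivariateGaussian 0 S}

/-- The ambiguity set: all centered normal distributions within Wasserstein distance `ρ` of the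
normal distribution with mean zero and covariance matrix `Sig`. -/
def ambiguitySet {p : ℕ} (ρ : ℝ) (Sig : Matrix (Fin p) (Fin p) ℝ) :
    Set (Measure (EuclideanSpace ℝ (Fin p))) :=
  {Q | Q ∈ centeredNormals p ∧
    wassersteinTwo Q (multivariateGaussian 0 Sig) ≤ ENNReal.ofReal ρ}

/-- The trace inner product `⟨A, B⟩ = Tr (Aᵀ B)`. -/
def traceInner {p : ℕ} (A B : Matrix (Fin p) (Fin p) ℝ) : ℝ :=
  (A.transpose * B).trace

/-- The worst-case expectation `sup_Q E^Q[⟨ξ ξᵀ, X⟩]` over the ambiguity set. The supremum is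
taken in the extended reals; each expectation is an integral of a quadratic form against a normal
distribution, so that it always exists. -/
def worstCaseExpectation {p : ℕ} (ρ : ℝ) (Sig X : Matrix (Fin p) (Fin p) ℝ) : EReal :=
  ⨆ Q ∈ ambiguitySet ρ Sig,
    ((∫ ξ : EuclideanSpace ℝ (Fin p), traceInner (Matrix.vecMulVec ξ ξ) X ∂Q : ℝ) : EReal)

/-- The objective function of the distributionally robust estimation problem. -/
def droObjective {p : ℕ} (ρ : ℝ) (Sig X : Matrix (Fin p) (Fin p) ℝ) : EReal :=
  ((-Real.log X.det : ℝ) : EReal) + worstCaseExpectation ρ Sig X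

/-- `x` is the one and only minimizer of `f` over the feasible set `s`. -/
def IsUniqueMinimizerOn {α : Type*} (f : α → EReal) (s : Set α) (x : α) : Prop :=
  x ∈ s ∧ IsMinOn f s x ∧ ∀ y ∈ s, IsMinOn f s y → y = x

end

/-! Put q_i = `shrinkageRoot (λ_i γ)`, so that q_i² = λ_i γ (1 - q_i) and x_i = γ (1 - q_i). The
equation for γ becomes ρ² γ + ∑ q_i = p, with a strictly increasing left side. At its root, X⋆ and S
= X⋆⁻¹ form a saddle point. S is feasible, since an explicit coupling of N(0, S) with the reference
law costs ∑ (1 - q_i) / γ = ρ² (`wassersteinTwo_spectralSum_le`, `sq_sub_sqrt_eq`). S is worst-case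
for X⋆, since weak duality with multiplier γ bounds every expectation by γ ρ² + ∑ q_i = p = Tr(S X⋆)
(`integral_traceInner_le_of_coupling`, `dual_pointwise_bound`). Hence -log det X + Tr(S X) bounds
the objective below, with equality at X⋆, and log t ≤ t - 1 makes X⋆ its only minimizer. No closed
formula for the distance between Gaussians is needed. -/

open Matrix

open scoped RealInnerProductSpace MatrixOrder

/-! ### The scalar equation for γ -/

/-- The root `√(t² + 4t)/2 - t/2` of the quadratic equation `q² + t q - t = 0`. -/
noncomputable def shrinkageRoot (t : ℝ) : ℝ := 1 / 2 * (√(t ^ 2 + 4 * t) - t)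

lemma shrinkageRoot_zero : shrinkageRoot 0 = 0 := by simp [shrinkageRoot]

lemma shrinkageRoot_sq {t : ℝ} (ht : 0 ≤ t) :
    shrinkageRoot t ^ 2 = t * (1 - shrinkageRoot t) := by
  have h := Real.sq_sqrt (show 0 ≤ t ^ 2 + 4 * t by positivity)
  unfold shrinkageRoot
  linear_combination h / 4

lemma shrinkageRoot_lt_one {t : ℝ} (ht : 0 ≤ t) : shrinkageRoot t < 1 := by
  have h : √(t ^ 2 + 4 * t) < t + 2 := by
    rw [Real.sqrt_lt' (by linarith)]
    linarith [sq_nonneg t]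
  unfold shrinkageRoot
  linarith

lemma monotoneOn_shrinkageRoot : MonotoneOn shrinkageRoot (Set.Ici 0) := by
  intro s hs t _ hst
  have hs : 0 ≤ s := hs
  have h₁ : √(s ^ 2 + 4 * s) ≤ s + 2 := Real.sqrt_le_iff.2 ⟨by linarith, by linarith⟩
  have h₂ := Real.sq_sqrt (show 0 ≤ s ^ 2 + 4 * s by positivity)
  have h₃ : √(s ^ 2 + 4 * s) + (t - s) ≤ √(t ^ 2 + 4 * t) := by
    apply Real.le_sqrt_of_sq_le
    -- The bound s + 2 on the root turns the square of the left side into at most s² + 4s + 2(s +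
    -- 2)(t - s) + (t - s)² = t² + 4t.
    nlinarith [mul_le_mul_of_nonneg_left h₁ (sub_nonneg.2 hst)]
  unfold shrinkageRoot
  linarith

lemma shrinkageRoot_nonneg {t : ℝ} (ht : 0 ≤ t) : 0 ≤ shrinkageRoot t := by
  simpa [shrinkageRoot_zero] using monotoneOn_shrinkageRoot (Set.mem_Ici.2 le_rfl) ht ht

lemma shrinkageRoot_pos {t : ℝ} (ht : 0 < t) : 0 < shrinkageRoot t := by
  refine lt_of_le_of_ne (shrinkageRoot_nonneg ht.le) fun h => ?_
  have := shrinkageRoot_sq ht.le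
  rw [← h] at this
  linarith

lemma continuous_shrinkageRoot : Continuous shrinkageRoot := by
  unfold shrinkageRoot
  fun_prop

/-- The coefficient ρ² - ½ ∑ λ_i may be negative; absorbing the linear terms into the roots makes
every summand monotone in γ. -/
lemma dual_equation_eq {p : ℕ} (ρ : ℝ) (lam : Fin p → ℝ) (γ : ℝ) :
    (ρ ^ 2 - 1 / 2 * ∑ i, lam i) * γ - p
      + 1 / 2 * ∑ i, √(lam i ^ 2 * γ ^ 2 + 4 * lam i * γ) =
    ρ ^ 2 * γ + ∑ i, shrinkageRoot (lam i * γ) - p := by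
  have h : ∑ i, shrinkageRoot (lam i * γ) =
      1 / 2 * ∑ i, √(lam i ^ 2 * γ ^ 2 + 4 * lam i * γ) - 1 / 2 * (∑ i, lam i) * γ := by
    simp only [shrinkageRoot, ← Finset.mul_sum, Finset.sum_sub_distrib, ← Finset.sum_mul,
      mul_pow, ← mul_assoc]
    ring
  rw [h]
  ring

lemma strictMonoOn_dual_equation {p : ℕ} {ρ : ℝ} (hρ : 0 < ρ) {lam : Fin p → ℝ}
    (hlam : ∀ i, 0 ≤ lam i) :
    StrictMonoOn (fun γ => ρ ^ 2 * γ + ∑ i, shrinkageRoot (lam i * γ)) (Set.Ici 0) := by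
  intro a ha b hb hab
  have ha : 0 ≤ a := ha
  have h₁ : ρ ^ 2 * a < ρ ^ 2 * b := by gcongr
  have h₂ : ∑ i, shrinkageRoot (lam i * a) ≤ ∑ i, shrinkageRoot (lam i * b) :=
    Finset.sum_le_sum fun i _ => monotoneOn_shrinkageRoot
      (mul_nonneg (hlam i) ha) (mul_nonneg (hlam i) hb)
      (mul_le_mul_of_nonneg_left hab.le (hlam i))
  exact add_lt_add_of_lt_of_le h₁ h₂

lemma exists_pos_dual_equation {p : ℕ} (hp : 0 < p) {ρ : ℝ} (hρ : 0 < ρ) {lam : Fin p → ℝ}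
    (hlam : ∀ i, 0 ≤ lam i) :
    ∃ γ, 0 < γ ∧ ρ ^ 2 * γ + ∑ i, shrinkageRoot (lam i * γ) = p := by
  have hp' : (0 : ℝ) < p := by exact_mod_cast hp
  have hc : ContinuousOn (fun γ => ρ ^ 2 * γ + ∑ i, shrinkageRoot (lam i * γ))
      (Set.Icc 0 (p / ρ ^ 2)) := by
    have := continuous_shrinkageRoot
    fun_prop
  have hq : 0 ≤ ∑ i, shrinkageRoot (lam i * (p / ρ ^ 2)) :=
    Finset.sum_nonneg fun i _ => shrinkageRoot_nonneg (mul_nonneg (hlam i) (by positivity))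
  -- The left side vanishes at 0, and at p / ρ² its linear term alone equals p.
  obtain ⟨γ, hγ, h⟩ := intermediate_value_Icc (by positivity) hc
    (show (p : ℝ) ∈ _ by
      refine ⟨by simp [shrinkageRoot_zero], ?_⟩
      have : ρ ^ 2 * (p / ρ ^ 2) = p := by field_simp
      simp only [this]
      linarith)
  refine ⟨γ, lt_of_le_of_ne hγ.1 ?_, h⟩
  rintro rfl
  simp [shrinkageRoot_zero] at h
  linarith

/-! ### Matrices diagonal in a fixed orthonormal basis -/

/-- The symmetric matrix with eigenvectors `v i` and eigenvalues `c i`. -/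
noncomputable def spectralSum {p : ℕ} (v : Fin p → EuclideanSpace ℝ (Fin p)) (c : Fin p → ℝ) :
    Matrix (Fin p) (Fin p) ℝ :=
  ∑ i, c i • vecMulVec (v i) (v i)

section SpectralSum

variable {p : ℕ} {v : Fin p → EuclideanSpace ℝ (Fin p)}

lemma spectralSum_eq (v : Fin p → EuclideanSpace ℝ (Fin p)) (c : Fin p → ℝ) :
    spectralSum v c =
      (of fun a i => v i a : Matrix (Fin p) (Fin p) ℝ) * diagonal c *
        (of fun a i => v i a : Matrix (Fin p) (Fin p) ℝ)ᵀ := by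
  ext a b
  rw [Matrix.mul_apply]
  simp only [spectralSum, Matrix.sum_apply, Matrix.smul_apply, vecMulVec_apply, smul_eq_mul,
    mul_diagonal, of_apply, transpose_apply]
  exact Finset.sum_congr rfl fun i _ => by ring

lemma Orthonormal.transpose_mul_self (hv : Orthonormal ℝ v) :
    (of fun a i => v i a : Matrix (Fin p) (Fin p) ℝ)ᵀ *
      (of fun a i => v i a : Matrix (Fin p) (Fin p) ℝ) = 1 := by
  ext i j
  have := orthonormal_iff_ite.1 hv i j
  simp only [PiLp.inner_apply, RCLike.inner_apply, conj_trivial] at this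
  simp only [mul_apply, transpose_apply, of_apply, one_apply, ← this]
  exact Finset.sum_congr rfl fun a _ => mul_comm _ _

lemma spectralSum_mul (hv : Orthonormal ℝ v) (c d : Fin p → ℝ) :
    spectralSum v c * spectralSum v d = spectralSum v (fun i => c i * d i) := by
  simp only [spectralSum_eq]
  rw [← diagonal_mul_diagonal]
  simp only [Matrix.mul_assoc]
  rw [← Matrix.mul_assoc _ᵀ _ (_ * _), hv.transpose_mul_self, Matrix.one_mul]

lemma spectralSum_one (hv : Orthonormal ℝ v) : spectralSum v (fun _ => 1) = 1 := by
  rw [spectralSum_eq, diagonal_one, Matrix.mul_one]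
  exact mul_eq_one_comm.1 hv.transpose_mul_self

lemma trace_spectralSum (hv : Orthonormal ℝ v) (c : Fin p → ℝ) :
    (spectralSum v c).trace = ∑ i, c i := by
  rw [spectralSum_eq, trace_mul_cycle, hv.transpose_mul_self, Matrix.one_mul, trace_diagonal]

lemma transpose_spectralSum (c : Fin p → ℝ) : (spectralSum v c)ᵀ = spectralSum v c := by
  simp [spectralSum, transpose_sum, transpose_vecMulVec]

lemma spectralSum_sub (c d : Fin p → ℝ) :
    spectralSum v c - spectralSum v d = spectralSum v (fun i => c i - d i) := by
  simp [spectralSum, sub_smul]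

lemma posSemidef_spectralSum {c : Fin p → ℝ} (hc : ∀ i, 0 ≤ c i) :
    (spectralSum v c).PosSemidef := by
  rw [spectralSum_eq, ← conjTranspose_eq_transpose_of_trivial]
  exact (PosSemidef.diagonal hc).mul_mul_conjTranspose_same _

lemma posDef_spectralSum (hv : Orthonormal ℝ v) {c : Fin p → ℝ} (hc : ∀ i, 0 < c i) :
    (spectralSum v c).PosDef := by
  have h : (spectralSum v c).det ≠ 0 := by
    intro h
    have := congrArg det (spectralSum_mul hv c (fun i => (c i)⁻¹))
    simp [h, mul_inv_cancel₀ (hc _).ne', spectralSum_one hv] at this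
  exact (posSemidef_spectralSum fun i => (hc i).le).posDef_iff_det_ne_zero.2 h

lemma dotProduct_mulVec_spectralSum (c : Fin p → ℝ) (x : EuclideanSpace ℝ (Fin p)) :
    x ⬝ᵥ spectralSum v c *ᵥ x = ∑ i, c i * ⟪v i, x⟫ ^ 2 := by
  simp only [spectralSum, sum_mulVec, dotProduct_sum, smul_mulVec, dotProduct_smul,
    vecMulVec_mulVec, EuclideanSpace.inner_eq_star_dotProduct, star_trivial, smul_eq_mul]
  refine Finset.sum_congr rfl fun i _ => ?_
  rw [op_smul_eq_smul, smul_eq_mul, dotProduct_comm (v i).ofLp]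
  ring

lemma norm_sq_eq_sum_inner_sq (hv : Orthonormal ℝ v) (x : EuclideanSpace ℝ (Fin p)) :
    ‖x‖ ^ 2 = ∑ i, ⟪v i, x⟫ ^ 2 := by
  have := dotProduct_mulVec_spectralSum (v := v) (fun _ => 1) x
  rw [spectralSum_one hv, one_mulVec] at this
  rw [EuclideanSpace.real_norm_sq_eq]
  simpa [dotProduct, sq] using this

lemma sqrt_spectralSum (hv : Orthonormal ℝ v) {c d : Fin p → ℝ} (hd : ∀ i, 0 ≤ d i)
    (hcd : ∀ i, d i ^ 2 = c i) :
    CFC.sqrt (spectralSum v c) = spectralSum v d := by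
  refine CFC.sqrt_unique ?_ (posSemidef_spectralSum hd).nonneg
  rw [spectralSum_mul hv]
  exact congrArg _ (funext fun i => by rw [← hcd, sq])

lemma eigenvalue_nonneg_of_posSemidef (hv : Orthonormal ℝ v) {c : Fin p → ℝ}
    (h : (spectralSum v c).PosSemidef) (i : Fin p) : 0 ≤ c i := by
  have h' := h.dotProduct_mulVec_nonneg (v i)
  rw [star_trivial, dotProduct_mulVec_spectralSum] at h'
  simpa [orthonormal_iff_ite.1 hv] using h'

end SpectralSum

/-! ### The inequality log det Y ≤ Tr Y - p and its equality case -/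

section LogDet

variable {n : Type*} [Fintype n] [DecidableEq n]

lemma Matrix.PosDef.log_det_le {Y : Matrix n n ℝ} (hY : Y.PosDef) :
    Real.log Y.det ≤ Y.trace - Fintype.card n := by
  have hd := hY.isHermitian.det_eq_prod_eigenvalues
  have ht := hY.isHermitian.trace_eq_sum_eigenvalues
  simp only [RCLike.ofReal_real_eq_id, id_eq] at hd ht
  rw [hd, ht, Real.log_prod fun i _ => (hY.eigenvalues_pos i).ne', Fintype.card_eq_sum_ones]
  push_cast
  rw [← Finset.sum_sub_distrib]
  exact Finset.sum_le_sum fun i _ => Real.log_le_sub_one_of_pos (hY.eigenvalues_pos i)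

lemma Matrix.PosDef.eq_one_of_log_det_eq {Y : Matrix n n ℝ} (hY : Y.PosDef)
    (h : Real.log Y.det = Y.trace - Fintype.card n) : Y = 1 := by
  have hd := hY.isHermitian.det_eq_prod_eigenvalues
  have ht := hY.isHermitian.trace_eq_sum_eigenvalues
  simp only [RCLike.ofReal_real_eq_id, id_eq] at hd ht
  rw [hd, ht, Real.log_prod fun i _ => (hY.eigenvalues_pos i).ne', Fintype.card_eq_sum_ones] at h
  push_cast at h
  rw [← Finset.sum_sub_distrib, Finset.sum_eq_sum_iff_of_le fun i _ =>
    Real.log_le_sub_one_of_pos (hY.eigenvalues_pos i)] at h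
  have he : hY.isHermitian.eigenvalues = 1 := by
    ext i
    by_contra hi
    exact (Real.log_lt_sub_one_of_pos (hY.eigenvalues_pos i) hi).ne (h i (Finset.mem_univ i))
  have := hY.isHermitian.spectral_theorem
  rw [he] at this
  simpa [Function.comp_def] using this

end LogDet

/-! ### Gaussian second moments, couplings and weak duality -/

section Gaussian

variable {p : ℕ}

lemma traceInner_vecMulVec (ξ : EuclideanSpace ℝ (Fin p)) (X : Matrix (Fin p) (Fin p) ℝ) :
    traceInner (vecMulVec ξ ξ) X = ξ ⬝ᵥ X *ᵥ ξ := by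
  rw [traceInner, transpose_vecMulVec, vecMulVec_mul, trace_vecMulVec, dotProduct_mulVec,
    dotProduct_comm]

lemma memLp_inner_multivariateGaussian (S : Matrix (Fin p) (Fin p) ℝ)
    (w : EuclideanSpace ℝ (Fin p)) :
    MemLp (fun ξ => ⟪w, ξ⟫) 2 (multivariateGaussian 0 S) :=
  IsGaussian.memLp_two_id.const_inner w

lemma memLp_eval_multivariateGaussian (S : Matrix (Fin p) (Fin p) ℝ) (a : Fin p) :
    MemLp (fun ξ : EuclideanSpace ℝ (Fin p) => ξ a) 2 (multivariateGaussian 0 S) := by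
  simpa [EuclideanSpace.inner_single_left] using
    memLp_inner_multivariateGaussian S (EuclideanSpace.single a 1)

lemma integral_eval_mul_eval_multivariateGaussian {S : Matrix (Fin p) (Fin p) ℝ}
    (hS : S.PosSemidef) (a b : Fin p) :
    ∫ ξ : EuclideanSpace ℝ (Fin p), ξ a * ξ b ∂multivariateGaussian 0 S = S a b := by
  have hmean (c : Fin p) : ∫ ξ : EuclideanSpace ℝ (Fin p), ξ c ∂multivariateGaussian 0 S = 0 := by
    have := ContinuousLinearMap.integral_comp_id_comm
      (μ := multivariateGaussian (0 : EuclideanSpace ℝ (Fin p)) S)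
      IsGaussian.integrable_id (EuclideanSpace.proj (𝕜 := ℝ) c)
    simpa using this
  rw [← covariance_eval_multivariateGaussian (μ := 0) hS a b,
    covariance_eq_sub (memLp_eval_multivariateGaussian S a) (memLp_eval_multivariateGaussian S b),
    hmean, hmean]
  simp

lemma integral_traceInner_multivariateGaussian {S : Matrix (Fin p) (Fin p) ℝ}
    (hS : S.PosSemidef) (X : Matrix (Fin p) (Fin p) ℝ) :
    ∫ ξ : EuclideanSpace ℝ (Fin p), traceInner (vecMulVec ξ ξ) X ∂multivariateGaussian 0 S =
      (S * X).trace := by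
  have hint (a b : Fin p) : Integrable (fun ξ : EuclideanSpace ℝ (Fin p) => ξ a * ξ b * X a b)
      (multivariateGaussian 0 S) :=
    ((memLp_eval_multivariateGaussian S a).integrable_mul
      (memLp_eval_multivariateGaussian S b)).mul_const _
  have hsum (ξ : EuclideanSpace ℝ (Fin p)) :
      traceInner (vecMulVec ξ ξ) X = ∑ a, ∑ b, ξ a * ξ b * X a b := by
    simp only [traceInner_vecMulVec, dotProduct, mulVec, Finset.mul_sum]
    exact Finset.sum_congr rfl fun a _ => Finset.sum_congr rfl fun b _ => by ring
  simp_rw [hsum]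
  rw [integral_finsetSum _ fun a _ => integrable_finsetSum _ fun b _ => hint a b]
  simp_rw [integral_finsetSum _ fun b _ => hint _ b, integral_mul_const,
    integral_eval_mul_eval_multivariateGaussian hS, trace, diag, Matrix.mul_apply]
  rw [Finset.sum_comm]
  refine Finset.sum_congr rfl fun b _ => Finset.sum_congr rfl fun a _ => ?_
  rw [← hS.isHermitian.apply a b, star_trivial]

lemma integral_inner_sq_multivariateGaussian {v : Fin p → EuclideanSpace ℝ (Fin p)}
    (hv : Orthonormal ℝ v) {c : Fin p → ℝ} (hc : ∀ i, 0 ≤ c i) (i : Fin p) :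
    ∫ ξ, ⟪v i, ξ⟫ ^ 2 ∂multivariateGaussian 0 (spectralSum v c) = c i := by
  have h := integral_traceInner_multivariateGaussian (posSemidef_spectralSum (v := v) hc)
    (spectralSum v (Pi.single i 1))
  simp_rw [traceInner_vecMulVec, dotProduct_mulVec_spectralSum, spectralSum_mul hv,
    trace_spectralSum hv] at h
  simpa [Pi.single_apply] using h

/-- One standard Gaussian vector is pushed through both square roots; these share eigenvectors, so
the cost is the trace of the squared difference. -/
lemma wassersteinTwo_spectralSum_le {v : Fin p → EuclideanSpace ℝ (Fin p)}
    (hv : Orthonormal ℝ v) {c d : Fin p → ℝ} (hc : ∀ i, 0 ≤ c i) (hd : ∀ i, 0 ≤ d i) :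
    wassersteinTwo (multivariateGaussian 0 (spectralSum v fun i => c i ^ 2))
      (multivariateGaussian 0 (spectralSum v fun i => d i ^ 2)) ≤
        ENNReal.ofReal √(∑ i, (c i - d i) ^ 2) := by
  set A := spectralSum v c
  set B := spectralSum v d
  have hA : CFC.sqrt (spectralSum v fun i => c i ^ 2) = A := sqrt_spectralSum hv hc fun _ => rfl
  have hB : CFC.sqrt (spectralSum v fun i => d i ^ 2) = B := sqrt_spectralSum hv hd fun _ => rfl
  let φ : EuclideanSpace ℝ (Fin p) → EuclideanSpace ℝ (Fin p) × EuclideanSpace ℝ (Fin p) :=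
    fun g => (0 + toEuclideanCLM (𝕜 := ℝ) A g, 0 + toEuclideanCLM (𝕜 := ℝ) B g)
  have hφ : Measurable φ := by fun_prop
  have hJ : IsCoupling (multivariateGaussian 0 (spectralSum v fun i => c i ^ 2))
      (multivariateGaussian 0 (spectralSum v fun i => d i ^ 2))
      ((stdGaussian (EuclideanSpace ℝ (Fin p))).map φ) := by
    constructor
    · rw [Measure.fst, Measure.map_map measurable_fst hφ, multivariateGaussian, hA]
      rfl
    · rw [Measure.snd, Measure.map_map measurable_snd hφ, multivariateGaussian, hB]
      rfl
  have hnorm (g : EuclideanSpace ℝ (Fin p)) : ‖(φ g).1 - (φ g).2‖ ^ 2 =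
      traceInner (vecMulVec g g) (spectralSum v fun i => (c i - d i) ^ 2) := by
    have h : (φ g).1 - (φ g).2 = toEuclideanCLM (𝕜 := ℝ) (spectralSum v fun i => c i - d i) g := by
      simp [φ, ← spectralSum_sub, A, B]
    rw [h, traceInner_vecMulVec, ← real_inner_self_eq_norm_sq, inner_toEuclideanCLM,
      ofLp_toEuclideanCLM]
    simp only [sq]
    rw [← spectralSum_mul hv, ← mulVec_mulVec, dotProduct_mulVec g.ofLp, ← mulVec_transpose,
      transpose_spectralSum]
  have hint : Integrable (fun g => ‖(φ g).1 - (φ g).2‖ ^ 2)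
      (stdGaussian (EuclideanSpace ℝ (Fin p))) := by
    have h : MemLp (fun g => (φ g).1 - (φ g).2) 2 (stdGaussian (EuclideanSpace ℝ (Fin p))) := by
      have := (IsGaussian.memLp_two_id
        (μ := stdGaussian (EuclideanSpace ℝ (Fin p)))).continuousLinearMap_comp
        (toEuclideanCLM (𝕜 := ℝ) (A - B))
      simpa [φ] using this
    exact h.integrable_norm_pow (by norm_num)
  have hcost : ∫⁻ z, ‖z.1 - z.2‖ₑ ^ 2 ∂((stdGaussian (EuclideanSpace ℝ (Fin p))).map φ) =
      ENNReal.ofReal (∑ i, (c i - d i) ^ 2) := by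
    rw [lintegral_map (by fun_prop) hφ]
    simp_rw [← ofReal_norm, ← ENNReal.ofReal_pow (norm_nonneg _)]
    rw [← ofReal_integral_eq_lintegral_ofReal hint (ae_of_all _ fun _ => by positivity)]
    simp_rw [hnorm]
    rw [← multivariateGaussian_zero_one, integral_traceInner_multivariateGaussian PosSemidef.one,
      Matrix.one_mul, trace_spectralSum hv]
  refine (iInf₂_le _ hJ).trans ?_
  rw [hcost, Real.sqrt_eq_rpow, ENNReal.ofReal_rpow_of_nonneg
    (Finset.sum_nonneg fun _ _ => sq_nonneg _) (by norm_num)]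

/-- The slack r > ρ avoids having to show that the infimum is attained. -/
lemma exists_coupling_lt {P₁ P₂ : Measure (EuclideanSpace ℝ (Fin p))} {ρ r : ℝ}
    (hρ : 0 ≤ ρ) (hr : ρ < r) (h : wassersteinTwo P₁ P₂ ≤ ENNReal.ofReal ρ) :
    ∃ J, IsCoupling P₁ P₂ J ∧ ∫⁻ z, ‖z.1 - z.2‖ₑ ^ 2 ∂J < ENNReal.ofReal (r ^ 2) := by
  have hr' : wassersteinTwo P₁ P₂ < ENNReal.ofReal r :=
    h.trans_lt ((ENNReal.ofReal_lt_ofReal_iff (hρ.trans_lt hr)).2 hr)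
  simp only [wassersteinTwo, iInf_lt_iff] at hr'
  obtain ⟨J, hJ, hlt⟩ := hr'
  refine ⟨J, hJ, ?_⟩
  have := ENNReal.rpow_lt_rpow hlt (show (0 : ℝ) < 2 by norm_num)
  rw [← ENNReal.rpow_mul] at this
  norm_num at this
  rwa [← ENNReal.ofReal_pow (hρ.trans hr.le)] at this

/-- Weak duality: a pointwise bound in the eigendirections, valid almost surely under the
reference normal distribution, controls the expected quadratic form under any measure that is
coupled with it. -/
lemma integral_traceInner_le_of_coupling {v : Fin p → EuclideanSpace ℝ (Fin p)}
    (hv : Orthonormal ℝ v) {lam : Fin p → ℝ} (hlam : ∀ i, 0 ≤ lam i)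
    {S : Matrix (Fin p) (Fin p) ℝ}
    {J : Measure (EuclideanSpace ℝ (Fin p) × EuclideanSpace ℝ (Fin p))}
    (hJ : IsCoupling (multivariateGaussian 0 S) (multivariateGaussian 0 (spectralSum v lam)) J)
    {r γ : ℝ} (hγ : 0 ≤ γ) (hcost : ∫⁻ z, ‖z.1 - z.2‖ₑ ^ 2 ∂J ≤ ENNReal.ofReal (r ^ 2))
    {x m : Fin p → ℝ}
    (hxm : ∀ i a b, (lam i = 0 → b = 0) → x i * a ^ 2 ≤ γ * (a - b) ^ 2 + m i * b ^ 2) :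
    ∫ ξ, traceInner (vecMulVec ξ ξ) (spectralSum v x) ∂multivariateGaussian 0 S ≤
      γ * r ^ 2 + ∑ i, m i * lam i := by
  have h₁ : MeasurePreserving Prod.fst J (multivariateGaussian 0 S) := ⟨measurable_fst, hJ.1⟩
  have h₂ : MeasurePreserving Prod.snd J (multivariateGaussian 0 (spectralSum v lam)) :=
    ⟨measurable_snd, hJ.2⟩
  have hL₁ (i : Fin p) : Integrable (fun z => ⟪v i, z.1⟫ ^ 2) J :=
    ((memLp_inner_multivariateGaussian S (v i)).comp_measurePreserving h₁).integrable_sq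
  have hL₂ (i : Fin p) : Integrable (fun z => ⟪v i, z.2⟫ ^ 2) J :=
    ((memLp_inner_multivariateGaussian _ (v i)).comp_measurePreserving h₂).integrable_sq
  have hI₂ (i : Fin p) : ∫ z, ⟪v i, z.2⟫ ^ 2 ∂J = lam i := by
    rw [← integral_inner_sq_multivariateGaussian hv hlam i, ← h₂.map_eq,
      integral_map measurable_snd.aemeasurable (by fun_prop)]
  have hLd : Integrable (fun z => ‖z.1 - z.2‖ ^ 2) J :=
    MemLp.integrable_norm_pow
      ((IsGaussian.memLp_two_id (μ := multivariateGaussian 0 S)).comp_measurePreserving h₁ |>.sub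
        ((IsGaussian.memLp_two_id
          (μ := multivariateGaussian 0 (spectralSum v lam))).comp_measurePreserving h₂))
      (by norm_num)
  have hd : ∫ z, ‖z.1 - z.2‖ ^ 2 ∂J ≤ r ^ 2 := by
    simp_rw [← ofReal_norm, ← ENNReal.ofReal_pow (norm_nonneg _)] at hcost
    rw [← ofReal_integral_eq_lintegral_ofReal hLd (ae_of_all _ fun _ => by positivity)] at hcost
    exact (ENNReal.ofReal_le_ofReal_iff (sq_nonneg r)).1 hcost
  -- A singular reference law has zero second moment along its null eigenvectors, so it does not
  -- charge those directions.
  have hae : ∀ᵐ z ∂J, ∀ i, lam i = 0 → ⟪v i, z.2⟫ = 0 := by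
    refine ae_all_iff.2 fun i => ?_
    by_cases hi : lam i = 0
    · have := (integral_eq_zero_iff_of_nonneg (fun _ => sq_nonneg _) (hL₂ i)).1 ((hI₂ i).trans hi)
      filter_upwards [this] with z hz _
      simpa using hz
    · exact ae_of_all _ fun _ h => absurd h hi
  calc ∫ ξ, traceInner (vecMulVec ξ ξ) (spectralSum v x) ∂multivariateGaussian 0 S
      = ∫ z, ∑ i, x i * ⟪v i, z.1⟫ ^ 2 ∂J := by
        simp_rw [traceInner_vecMulVec, dotProduct_mulVec_spectralSum]
        rw [← h₁.map_eq, integral_map measurable_fst.aemeasurable (by fun_prop)]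
    _ ≤ ∫ z, (γ * ‖z.1 - z.2‖ ^ 2 + ∑ i, m i * ⟪v i, z.2⟫ ^ 2) ∂J := by
        refine integral_mono_ae (integrable_finsetSum _ fun i _ => (hL₁ i).const_mul _)
          ((hLd.const_mul _).add (integrable_finsetSum _ fun i _ => (hL₂ i).const_mul _)) ?_
        filter_upwards [hae] with z hz
        rw [norm_sq_eq_sum_inner_sq hv, Finset.mul_sum, ← Finset.sum_add_distrib]
        simp_rw [inner_sub_right]
        exact Finset.sum_le_sum fun i _ => hxm i _ _ (hz i)
    _ = γ * ∫ z, ‖z.1 - z.2‖ ^ 2 ∂J + ∑ i, m i * lam i := by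
        rw [integral_add (hLd.const_mul _)
          (integrable_finsetSum _ fun i _ => (hL₂ i).const_mul _), integral_const_mul,
          integral_finsetSum _ fun i _ => (hL₂ i).const_mul _]
        simp_rw [integral_const_mul, hI₂]
    _ ≤ γ * r ^ 2 + ∑ i, m i * lam i := by gcongr

end Gaussian

/-! ### From a saddle point to the unique minimizer -/

section SaddlePoint

variable {p : ℕ} {ρ : ℝ} {Sig : Matrix (Fin p) (Fin p) ℝ}

lemma le_droObjective {S : Matrix (Fin p) (Fin p) ℝ} (hS : S.PosSemidef)
    (hmem : multivariateGaussian 0 S ∈ ambiguitySet ρ Sig) (X : Matrix (Fin p) (Fin p) ℝ) :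
    ((-Real.log X.det + (S * X).trace : ℝ) : EReal) ≤ droObjective ρ Sig X := by
  rw [droObjective, EReal.coe_add]
  gcongr
  rw [← integral_traceInner_multivariateGaussian hS X]
  exact le_iSup₂_of_le _ hmem le_rfl

lemma droObjective_le {X : Matrix (Fin p) (Fin p) ℝ} {b : ℝ}
    (h : ∀ Q ∈ ambiguitySet ρ Sig,
      ∫ ξ : EuclideanSpace ℝ (Fin p), traceInner (vecMulVec ξ ξ) X ∂Q ≤ b) :
    droObjective ρ Sig X ≤ ((-Real.log X.det + b : ℝ) : EReal) := by
  rw [droObjective, EReal.coe_add]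
  gcongr
  exact iSup₂_le fun Q hQ => EReal.coe_le_coe_iff.2 (h Q hQ)

/-- If `S = X₀⁻¹` is a covariance matrix in the ambiguity set that is worst-case for `X₀`, then
`X₀` is the unique minimizer. -/
lemma isUniqueMinimizerOn_of_saddlePoint {B X₀ : Matrix (Fin p) (Fin p) ℝ} (hB : B.PosDef)
    (hX₀ : X₀.PosDef) (hBX : B * B * X₀ = 1)
    (hmem : multivariateGaussian 0 (B * B) ∈ ambiguitySet ρ Sig)
    (hworst : ∀ Q ∈ ambiguitySet ρ Sig,
      ∫ ξ : EuclideanSpace ℝ (Fin p), traceInner (vecMulVec ξ ξ) X₀ ∂Q ≤ p) :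
    IsUniqueMinimizerOn (droObjective ρ Sig) {X | X.PosDef} X₀ := by
  have hBH : Bᴴ = B := hB.isHermitian
  have hS : (B * B).PosSemidef := by
    have := posSemidef_conjTranspose_mul_self B
    rwa [hBH] at this
  have hX₀det : Real.log X₀.det = -Real.log (B.det * B.det) := by
    have h := congrArg det hBX
    rw [det_mul, det_mul, det_one] at h
    rw [← Real.log_inv, ← eq_inv_of_mul_eq_one_right h]
  have hconj {X : Matrix (Fin p) (Fin p) ℝ} (hX : X.PosDef) : (B * X * B).PosDef := by
    have := hX.mul_mul_conjTranspose_same (B := B)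
      (vecMul_injective_iff_isUnit.2 hB.isUnit)
    rwa [hBH] at this
  have htr (X : Matrix (Fin p) (Fin p) ℝ) : (B * X * B).trace = (B * B * X).trace := by
    rw [trace_mul_cycle]
  have hdet {X : Matrix (Fin p) (Fin p) ℝ} (hX : X.PosDef) :
      Real.log (B * X * B).det = Real.log X.det + Real.log (B.det * B.det) := by
    rw [← Real.log_mul hX.det_pos.ne' (mul_pos hB.det_pos hB.det_pos).ne', det_mul, det_mul]
    congr 1
    ring
  -- The log-determinant inequality is applied to B X B, which is positive definite with trace Tr(B²
  -- X); equality there forces B X B = 1.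
  have hle {X : Matrix (Fin p) (Fin p) ℝ} (hX : X.PosDef) :
      -Real.log X₀.det + p ≤ -Real.log X.det + (B * B * X).trace := by
    have := (hconj hX).log_det_le
    rw [hdet hX, htr, Fintype.card_fin] at this
    linarith
  refine ⟨hX₀, fun X hX => (droObjective_le hworst).trans
    ((EReal.coe_le_coe_iff.2 (hle hX)).trans (le_droObjective hS hmem X)), fun X hX hmin => ?_⟩
  have h := (le_droObjective hS hmem X).trans ((hmin hX₀).trans (droObjective_le hworst))
  have h := le_antisymm (EReal.coe_le_coe_iff.1 h) (hle hX)
  have h₁ : B * X * B = 1 := (hconj hX).eq_one_of_log_det_eq (by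
    rw [hdet hX, htr, Fintype.card_fin]
    linarith)
  have h₂ : B * B * X = 1 := by
    rw [Matrix.mul_assoc]
    exact mul_eq_one_comm.1 h₁
  exact left_inv_eq_right_inv (mul_eq_one_comm.1 h₂) hBX

end SaddlePoint

/-! ### Scalar identities at the saddle point and conclusion -/

lemma dual_pointwise_bound {l γ a b : ℝ} (hl : 0 ≤ l) (hγ : 0 < γ) (hb : l = 0 → b = 0) :
    γ * (1 - shrinkageRoot (l * γ)) * a ^ 2 ≤
      γ * (a - b) ^ 2 + shrinkageRoot (l * γ) / l * b ^ 2 := by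
  rcases hl.eq_or_lt with rfl | hl
  -- For l = 0 the quotient q / l is 0 by convention, and b = 0 gives equality.
  · simp [hb rfl, shrinkageRoot_zero]
  have ht : 0 < l * γ := mul_pos hl hγ
  have hq := shrinkageRoot_pos ht
  have hsq := shrinkageRoot_sq ht.le
  set q := shrinkageRoot (l * γ)
  have h : q / l = γ * (1 - q) / q := by
    field_simp
    linarith
  -- The choice q / l is the one that makes the gap a perfect square.
  have key : γ * (a - b) ^ 2 + q / l * b ^ 2 - γ * (1 - q) * a ^ 2 = γ / q * (q * a - b) ^ 2 := by
    rw [h]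
    field_simp
    ring
  have : 0 ≤ γ / q * (q * a - b) ^ 2 := by positivity
  linarith

/-- With x = γ (1 - q), the quadratic relation reads q² = l x, so √l = q / √x and the left side is
(1 - q)² / x. -/
lemma sq_sub_sqrt_eq {l γ : ℝ} (hl : 0 ≤ l) (hγ : 0 < γ) :
    ((√(γ * (1 - shrinkageRoot (l * γ))))⁻¹ - √l) ^ 2 = (1 - shrinkageRoot (l * γ)) / γ := by
  have ht : 0 ≤ l * γ := mul_nonneg hl hγ.le
  have hq := shrinkageRoot_nonneg ht
  have hq1 := sub_pos.2 (shrinkageRoot_lt_one ht)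
  have hsq := shrinkageRoot_sq ht
  set q := shrinkageRoot (l * γ)
  have hx : 0 < γ * (1 - q) := mul_pos hγ hq1
  have h : √l = q * (√(γ * (1 - q)))⁻¹ := by
    rw [Real.sqrt_eq_iff_mul_self_eq hl (by positivity), mul_mul_mul_comm, ← mul_inv,
      Real.mul_self_sqrt hx.le]
    field_simp
    linarith
  rw [h, ← one_sub_mul, mul_pow, inv_pow, Real.sq_sqrt hx.le]
  field_simp

theorem theorem3p1 (p : ℕ) (hp : 0 < p) (ρ : ℝ) (hρ : 0 < ρ)
    (Sig : Matrix (Fin p) (Fin p) ℝ) (hSig : Sig.PosSemidef)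
    (lam : Fin p → ℝ) (v : Fin p → EuclideanSpace ℝ (Fin p)) (hv : Orthonormal ℝ v)
    (hdecomp : Sig = ∑ i, lam i • Matrix.vecMulVec (v i) (v i)) :
    ∃ γ : ℝ,
      (0 < γ ∧
        (ρ ^ 2 - 1 / 2 * ∑ i, lam i) * γ - p
          + 1 / 2 * ∑ i, √(lam i ^ 2 * γ ^ 2 + 4 * lam i * γ) = 0) ∧
      (∀ γ' : ℝ, 0 < γ' →
        (ρ ^ 2 - 1 / 2 * ∑ i, lam i) * γ' - p
          + 1 / 2 * ∑ i, √(lam i ^ 2 * γ' ^ 2 + 4 * lam i * γ') = 0 → γ' = γ) ∧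
      IsUniqueMinimizerOn (droObjective ρ Sig)
        {X : Matrix (Fin p) (Fin p) ℝ | X.PosDef}
        (∑ i, (γ * (1 - 1 / 2 * (√(lam i ^ 2 * γ ^ 2 + 4 * lam i * γ) - lam i * γ))) •
          Matrix.vecMulVec (v i) (v i)) := by
  obtain rfl : Sig = spectralSum v lam := hdecomp
  have hlam := eigenvalue_nonneg_of_posSemidef hv hSig
  obtain ⟨γ, hγ, hγeq⟩ := exists_pos_dual_equation hp hρ hlam
  simp only [dual_equation_eq, sub_eq_zero]
  refine ⟨γ, ⟨hγ, hγeq⟩, fun γ' hγ' h => (strictMonoOn_dual_equation hρ hlam).injOn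
    (Set.mem_Ici.2 hγ'.le) (Set.mem_Ici.2 hγ.le) (h.trans hγeq.symm), ?_⟩
  set x : Fin p → ℝ := fun i => γ * (1 - shrinkageRoot (lam i * γ)) with hx_def
  have hx (i : Fin p) : 0 < x i :=
    mul_pos hγ (sub_pos.2 (shrinkageRoot_lt_one (mul_nonneg (hlam i) hγ.le)))
  have hX : (∑ i, (γ * (1 - 1 / 2 * (√(lam i ^ 2 * γ ^ 2 + 4 * lam i * γ) - lam i * γ))) •
      vecMulVec (v i) (v i)) = spectralSum v x := by
    simp only [spectralSum, hx_def, shrinkageRoot, mul_pow, ← mul_assoc]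
  have hsqrt (i : Fin p) : 0 < (√(x i))⁻¹ := inv_pos.2 (Real.sqrt_pos.2 (hx i))
  rw [hX]
  -- B is the inverse square root of X⋆, so that B² = X⋆⁻¹ is the worst-case covariance.
  refine isUniqueMinimizerOn_of_saddlePoint (B := spectralSum v fun i => (√(x i))⁻¹)
    (posDef_spectralSum hv hsqrt) (posDef_spectralSum hv hx) ?_ ?_ ?_
  · rw [spectralSum_mul hv, spectralSum_mul hv, ← spectralSum_one hv]
    refine congrArg _ (funext fun i => ?_)
    rw [← mul_inv, Real.mul_self_sqrt (hx i).le, inv_mul_cancel₀ (hx i).ne']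
  · rw [spectralSum_mul hv]
    refine ⟨⟨_, posSemidef_spectralSum fun i => mul_self_nonneg _, rfl⟩, ?_⟩
    have h := wassersteinTwo_spectralSum_le hv (fun i => (hsqrt i).le)
      (fun i => Real.sqrt_nonneg (lam i))
    simp only [Real.sq_sqrt (hlam _), hx_def, sq_sub_sqrt_eq (hlam _) hγ] at h
    -- By the equation for γ, p - ∑ q_i = ρ² γ: the coupling cost is exactly ρ².
    have hsum : ∑ i, (1 - shrinkageRoot (lam i * γ)) / γ = ρ ^ 2 := by
      rw [← Finset.sum_div, Finset.sum_sub_distrib, div_eq_iff hγ.ne']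
      simp only [Finset.sum_const, Finset.card_univ, Fintype.card_fin, nsmul_eq_mul, mul_one]
      linarith
    rw [hsum, Real.sqrt_sq hρ.le] at h
    simpa only [sq] using h
  · rintro Q ⟨⟨S, -, rfl⟩, hW⟩
    have hbound (r : ℝ) (hr : r ∈ Set.Ioi ρ) :
        ∫ ξ : EuclideanSpace ℝ (Fin p), traceInner (vecMulVec ξ ξ) (spectralSum v x)
          ∂multivariateGaussian 0 S ≤ γ * r ^ 2 + ∑ i, shrinkageRoot (lam i * γ) := by
      obtain ⟨J, hJ, hcost⟩ := exists_coupling_lt hρ.le hr hW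
      refine (integral_traceInner_le_of_coupling hv hlam hJ hγ.le hcost.le
        fun i a b => dual_pointwise_bound (hlam i) hγ).trans_eq ?_
      congr 1
      refine Finset.sum_congr rfl fun i _ => ?_
      rcases eq_or_ne (lam i) 0 with h | h
      · simp [h, shrinkageRoot_zero]
      · exact div_mul_cancel₀ _ h
    -- Letting r decrease to ρ removes the slack.
    have hlim : Filter.Tendsto (fun r => γ * r ^ 2 + ∑ i, shrinkageRoot (lam i * γ))
        (nhdsWithin ρ (Set.Ioi ρ)) (nhds (γ * ρ ^ 2 + ∑ i, shrinkageRoot (lam i * γ))) :=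
      (Continuous.tendsto (by fun_prop) ρ).mono_left nhdsWithin_le_nhds
    have := ge_of_tendsto hlim (eventually_nhdsWithin_of_forall hbound)
    linarith
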